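/- **Setting.** Consider one level of the RLFD detector with $m$ counters, $n$ legitimate flows, each of rate $\gamma>0$, and one large flow of rate $\alpha\gamma$ with $\alpha>1$. The $n+1$ flows are hashed into the $m$ counters independently and uniformly at random. After a period of length $T>0$ the value of a counter is the total traffic volume (rate times $T$) of the flows hashed to it, and RLFD selects the counter of largest value. Let $P_{\mathrm{worst}}(m,n,\alpha)$ be the probability that the counter holding the large flow has a strictly larger value than every other counter (so that it is selected however ties are broken). Let $Q(x,r)=\sum_{0\le k\le x}e^{-r}r^k/k!$ be the cumulative distribution function of the Poisson distribution of mean $r$ (so $Q(x,r)=0$ for $x<0$), and let $\log$ be the natural logarithm. **Theorem.** The quantity $1-Q(K,\frac nm)$ is an asymptotic lower bound for $P_{\mathrm{worst}}(m,n,\alpha)$, uniformly in $\alpha$, $\gamma$ and $T$, in the following sense. 1. For every $\varepsilon>0$ there are $m_0\in\mathbb N$ and $C\in\mathbb R$ such that for all $m\ge m_0$, all $n\ge C\,m(\log m)^2$ and all $\alpha>1$, $\gamma>0$, $T>0$, $$P_{\mathrm{worst}}(m,n,\alpha)\ \ge\ 1-Q\!\left(K,\tfrac nm\right)-\varepsilon,\qquad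 K=\Big\lfloor \tfrac nm+\sqrt{2\tfrac nm\log n}-\alpha\Big\rfloor .$$ 2. For every $\lambda>1$ and $\varepsilon>0$ there are $m_0\in\mathbb N$ and $C\in\mathbb R$ such that for all $m\ge m_0$, all $n\ge C\,m\log m$ and all $\alpha>1$, $\gamma>0$, $T>0$, $$P_{\mathrm{worst}}(m,n,\alpha)\ \ge\ 1-Q\!\left(K_\lambda,\tfrac nm\right)-\varepsilon,\qquad K_\lambda=\Big\lfloor \tfrac nm+\lambda\sqrt{2\tfrac nm\log n}-\alpha\Big\rfloor .$$ In other words, $P_{\mathrm{worst}}\ge 1-Q(K,\frac nm)-o(1)$ as $m\to\infty$ with $n\gg m(\log m)^2$, and $P_{\mathrm{worst}}\ge 1-Q(K_\lambda,\frac nm)-o(1)$ for each fixed $\lambda>1$ as $m\to\infty$ with $n\gg m\log m$. -/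

import Mathlib

open scoped NNReal

noncomputable section

/-- The flows seen by one level: `some i` (`i : Fin n`) are the `n` legitimate flows,
`none` is the large flow. -/
abbrev LevelFlow (n : ℕ) : Type := Option (Fin n)

/-- Every legitimate flow has the full rate `γ`, the large flow has the rate `α * γ`. -/
def flowRate {n : ℕ} (γ α : ℝ) : LevelFlow n → ℝ
  | none => α * γ
  | some _ => γ

/-- The value of counter `c` at the end of a period of length `T`, when the flows are hashed
into the `m` counters by `h`: the total traffic volume of the flows hashed to `c`. -/
def counterValue {m n : ℕ} (T γ α : ℝ) (h : LevelFlow n → Fin m) (c : Fin m) : ℝ :=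
  ∑ f : LevelFlow n, if h f = c then flowRate γ α f * T else 0

/-- The detector picks a counter of maximum value. The counter of the large flow is correctly
selected if its value is strictly larger than that of each other counter, so that it is picked
however ties are broken. -/
def CorrectlySelects {m n : ℕ} (T γ α : ℝ) (h : LevelFlow n → Fin m) : Prop :=
  ∀ c : Fin m, c ≠ h none → counterValue T γ α h c < counterValue T γ α h (h none)

open Classical in
/-- The probability that the counter of the large flow is correctly selected, when the hash
function is uniformly random, that is, when the `n + 1` flows are assigned to the `m` counters
independently and uniformly. -/
def selectProb (m n : ℕ) (T γ α : ℝ) : ℝ :=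
  (Fintype.card {h : LevelFlow n → Fin m // CorrectlySelects T γ α h} : ℝ) /
    (Fintype.card (LevelFlow n → Fin m) : ℝ)

/-- `Q(K, r)`: the cumulative distribution function of the Poisson distribution of mean `r`,
at an integer `K` (it is `0` for `K < 0`). -/
def poissonCDF (K : ℤ) (r : ℝ≥0) : ℝ :=
  (ProbabilityTheory.poissonMeasure r).real {k : ℕ | (k : ℤ) ≤ K}

end

/-!
Write `r = n / m`. Since all legitimate flows have the same rate, the large flow is correctly
selected as soon as its counter receives more than `M - α` legitimate flows while no counter
receives more than `M` of them. By the union bound over the `m` counters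
(`loadProb_sub_le_selectProb`) it remains to study the load of a single counter, which is
binomial with parameters `n` and `p = 1 / m`.

*Poisson approximation.* The ratio of the binomial to the Poisson weight at `k` is at least
`1 - (k - r) ^ 2 / (n - r)`, because `j! (e / j) ^ j` is nondecreasing in `j`
(`poisson_mul_le_binomial`). Summing over a set and using that the Poisson variance is `r`, every
set has binomial probability at least its Poisson probability minus `1 / (m - 1)`, however large
`n` is (`poissonMeasure_sub_le_loadProb`).

*Upper tail.* Chernoff's bound with exponent `θ = √(2 log n / r)`, the relative deviation of
`r + √(2 r log n)`, and `exp θ ≤ 1 + θ + θ ^ 2 / 2 + θ ^ 3 / 2` leave the exponent `- log n` up to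
the cubic term, which contributes at most `θ log n`. It is absorbed by taking the threshold
`M = r + √(2 r log n) + log n` (`loadProb_gt_add_log_le`) or, when `θ ≤ 2 (lam - 1)`, the threshold
`M = r + lam √(2 r log n)` (`loadProb_gt_mul_sqrt_le`). In both cases the union bound costs
`m / n = 1 / r`.

For `n ≥ C m log m` the second choice of `M` is exactly the threshold of the claim. For
`n ≥ C m (log m) ^ 2` the first one exceeds it by `log n`, which is small compared with the standard
deviation `√r`; as the Poisson weights are at most `4 / √r` (`poissonMeasure_real_singleton_le`), the
shift changes the Poisson probability by a small amount (`poissonMeasure_gt_le_gt_add`).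
-/

open scoped NNReal
open MeasureTheory ProbabilityTheory

/-! ### Moments and weights of the Poisson distribution -/

lemma poisson_hasSum_mul_id (r : ℝ≥0) :
    HasSum (fun k : ℕ ↦ Real.exp (-r) * (r : ℝ) ^ k / k.factorial * k) r := by
  rw [← hasSum_nat_add_iff' 1]
  convert! (hasSum_one_poissonMeasure r).mul_left (r : ℝ) using 1
  · ext k
    rw [Nat.factorial_succ]
    push_cast
    field_simp
    ring
  · simp

lemma poisson_hasSum_mul_descFactorial_two (r : ℝ≥0) :
    HasSum (fun k : ℕ ↦ Real.exp (-r) * (r : ℝ) ^ k / k.factorial * (k * (k - 1)))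
      ((r : ℝ) ^ 2) := by
  rw [← hasSum_nat_add_iff' 2]
  convert! (hasSum_one_poissonMeasure r).mul_left ((r : ℝ) ^ 2) using 1
  · ext k
    rw [Nat.factorial_succ, Nat.factorial_succ]
    push_cast
    field_simp
    ring
  · simp [Finset.sum_range_succ]

/-- The variance of the Poisson distribution is its mean. -/
lemma poisson_hasSum_variance (r : ℝ≥0) :
    HasSum (fun k : ℕ ↦ Real.exp (-r) * (r : ℝ) ^ k / k.factorial * ((k : ℝ) - r) ^ 2) r := by
  have h := ((poisson_hasSum_mul_descFactorial_two r).add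
    ((poisson_hasSum_mul_id r).mul_left (1 - 2 * (r : ℝ)))).add
    ((hasSum_one_poissonMeasure r).mul_left ((r : ℝ) ^ 2))
  convert! h using 1
  · ext k
    ring
  · ring

lemma poissonMeasure_hasSum_indicator (r : ℝ≥0) (S : Set ℕ) :
    HasSum (fun k : ℕ ↦ Real.exp (-r) * (r : ℝ) ^ k / k.factorial * S.indicator 1 k)
      ((poissonMeasure r).real S) := by
  have hS : MeasurableSet S := .of_discrete
  have hi : Integrable (S.indicator (1 : ℕ → ℝ)) (poissonMeasure r) :=
    (integrable_const (1 : ℝ)).indicator hS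
  simpa [integral_indicator_one hS] using hasSum_integral_poissonMeasure hi

/-- The Poisson weights are `O(1 / √r)`. Stirling's bound gives this for `k ≥ r / 2`, and
the variance bounds the weights with `k < r / 2` by `4 / r`. -/
lemma poissonMeasure_real_singleton_le {r : ℝ≥0} (hr : 1 ≤ r) (k : ℕ) :
    (poissonMeasure r).real {k} ≤ 4 / √r := by
  have hr1 : (1 : ℝ) ≤ r := by exact_mod_cast hr
  have hr0 : (0 : ℝ) < r := by linarith
  have hsr : 0 < √(r : ℝ) := Real.sqrt_pos.mpr hr0
  have hss : √(r : ℝ) * √r = r := Real.mul_self_sqrt hr0.le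
  rw [poissonMeasure_real_singleton]
  set w := Real.exp (-(r : ℝ)) * (r : ℝ) ^ k / k.factorial with hw
  have hw0 : 0 ≤ w := by positivity
  rw [le_div_iff₀ hsr]
  rcases lt_or_ge (k : ℝ) (r / 2) with hk | hk
  · have h1 : w * ((k : ℝ) - r) ^ 2 ≤ r :=
      le_hasSum (poisson_hasSum_variance r) k fun j _ ↦ by positivity
    have h2 : (r : ℝ) ^ 2 / 4 ≤ ((k : ℝ) - r) ^ 2 := by nlinarith
    have h3 : w * ((r : ℝ) ^ 2 / 4) ≤ r := le_trans (by gcongr) h1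
    have h4 : w * r ≤ 4 := by
      refine le_of_mul_le_mul_right ?_ hr0
      nlinarith
    refine le_trans ?_ h4
    gcongr
    rw [Real.sqrt_le_left hr0.le]
    nlinarith
  · have hk0 : (0 : ℝ) < k := by linarith
    have h1 := Stirling.le_factorial_stirling k
    have h2 : √(r : ℝ) ≤ √(2 * Real.pi * k) := by
      apply Real.sqrt_le_sqrt
      nlinarith [Real.pi_gt_three]
    have h3 : (r : ℝ) ^ k ≤ Real.exp r * (k / Real.exp 1) ^ k := by
      have h := Real.add_one_le_exp ((r : ℝ) / k - 1)
      rw [sub_add_cancel, div_le_iff₀ hk0] at h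
      calc (r : ℝ) ^ k ≤ (Real.exp ((r : ℝ) / k - 1) * k) ^ k := by gcongr
        _ = _ := by
          rw [mul_pow, ← Real.exp_nat_mul, div_pow, ← Real.exp_nat_mul,
            mul_sub, mul_div_cancel₀ _ hk0.ne', Real.exp_sub]
          ring
    have e : Real.exp (-(r : ℝ)) * Real.exp r = 1 := by rw [← Real.exp_add]; simp
    have h4 : w * √(r : ℝ) ≤ 1 := by
      rw [hw, div_mul_eq_mul_div, div_le_one (by positivity)]
      calc _ ≤ Real.exp (-(r : ℝ)) * (Real.exp r * (k / Real.exp 1) ^ k) *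
            √(2 * Real.pi * k) := by gcongr
        _ = √(2 * Real.pi * k) * (k / Real.exp 1) ^ k := by
            linear_combination ((k / Real.exp 1) ^ k * √(2 * Real.pi * k)) * e
        _ ≤ _ := h1
    linarith

/-! ### Comparison of the binomial and the Poisson distribution -/

/-- The sequence `j! (e / j) ^ j` is nondecreasing. -/
lemma monotone_factorial_mul_exp_div_pow :
    Monotone fun j : ℕ ↦ (j.factorial : ℝ) * Real.exp j / (j : ℝ) ^ j := by
  refine monotone_nat_of_le_succ fun j ↦ ?_
  rcases Nat.eq_zero_or_pos j with rfl | hj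
  · simp
  have hj' : (0 : ℝ) < j := by exact_mod_cast hj
  have key : ((j : ℝ) + 1) ^ j ≤ Real.exp 1 * (j : ℝ) ^ j := by
    have h1 : (1 + 1 / (j : ℝ)) ^ j ≤ Real.exp 1 := by
      calc (1 + 1 / (j : ℝ)) ^ j ≤ Real.exp (1 / j) ^ j := by
            gcongr
            linarith [Real.add_one_le_exp (1 / (j : ℝ))]
        _ = Real.exp 1 := by
            rw [← Real.exp_nat_mul]
            congr 1
            field_simp
    calc ((j : ℝ) + 1) ^ j = (1 + 1 / (j : ℝ)) ^ j * (j : ℝ) ^ j := by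
          rw [← mul_pow]
          congr 1
          field_simp
      _ ≤ _ := by gcongr
  rw [div_le_div_iff₀ (by positivity) (by positivity), Nat.factorial_succ]
  push_cast
  rw [Real.exp_add, pow_succ]
  calc (j.factorial : ℝ) * Real.exp j * (((j : ℝ) + 1) ^ j * (j + 1))
      ≤ (j.factorial : ℝ) * Real.exp j * ((Real.exp 1 * (j : ℝ) ^ j) * (j + 1)) := by gcongr
    _ = _ := by ring

/-- Comparison of the binomial and the Poisson weights at `k`: their ratio is at least
`exp (- (k - r) ^ 2 / (n - r))`, hence at least `1 - (k - r) ^ 2 / (n - r)`, where `r = n p`. -/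
lemma poisson_mul_le_binomial {n k : ℕ} (hk : k ≤ n) (hn : 0 < n) {p : ℝ} (hp0 : 0 ≤ p)
    (hp1 : p < 1) :
    Real.exp (-(n * p)) * (n * p) ^ k / k.factorial *
        (1 - ((k : ℝ) - n * p) ^ 2 / (n - n * p)) ≤
      n.choose k * p ^ k * (1 - p) ^ (n - k) := by
  obtain ⟨j, rfl⟩ := Nat.exists_eq_add_of_le hk
  rw [Nat.add_sub_cancel_left]
  set N : ℝ := ((k + j : ℕ) : ℝ) with hN
  have hNpos : 0 < N := Nat.cast_pos.mpr hn
  have hq : 0 < 1 - p := by linarith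
  have hNq : 0 < N - N * p := by nlinarith
  have hNkj : N = k + j := by push_cast [hN]; rfl
  -- a lower bound for the descending factorial
  have h1 : (j.factorial : ℝ) * Real.exp (-k) * N ^ (k + j) ≤
      ((k + j).factorial : ℝ) * (j : ℝ) ^ j := by
    have h := monotone_factorial_mul_exp_div_pow (Nat.le_add_left j k)
    have hjj : (0 : ℝ) < (j : ℝ) ^ j := by
      rcases Nat.eq_zero_or_pos j with rfl | hj
      · simp
      · positivity
    simp only at h
    rw [← hN, div_le_div_iff₀ hjj (by positivity), hNkj, Real.exp_add, ← hNkj] at h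
    have e : Real.exp (-(k : ℝ)) * Real.exp k = 1 := by rw [← Real.exp_add]; simp
    have := mul_le_mul_of_nonneg_left h
      (by positivity : 0 ≤ Real.exp (-(k : ℝ)) * Real.exp (-(j : ℝ)))
    have e' : Real.exp (-(j : ℝ)) * Real.exp j = 1 := by rw [← Real.exp_add]; simp
    calc (j.factorial : ℝ) * Real.exp (-k) * N ^ (k + j)
        = Real.exp (-(k : ℝ)) * Real.exp (-(j : ℝ)) *
            ((j.factorial : ℝ) * Real.exp j * N ^ (k + j)) := by
          linear_combination (-(j.factorial : ℝ) * Real.exp (-k) * N ^ (k + j)) * e'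
      _ ≤ _ := this
      _ = ((k + j).factorial : ℝ) * (j : ℝ) ^ j *
            ((Real.exp (-(k : ℝ)) * Real.exp k) * (Real.exp (-(j : ℝ)) * Real.exp j)) := by ring
      _ = _ := by rw [e, e']; ring
  -- `x ≤ exp (x - 1)` at `x = j / (N - N p)`
  have h2 : (j : ℝ) ^ j * Real.exp (-(j * (j / (N - N * p) - 1))) ≤ (N - N * p) ^ j := by
    have h := Real.add_one_le_exp ((j : ℝ) / (N - N * p) - 1)
    rw [sub_add_cancel, div_le_iff₀ hNq] at h
    calc (j : ℝ) ^ j * Real.exp (-(j * (j / (N - N * p) - 1)))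
        ≤ (Real.exp ((j : ℝ) / (N - N * p) - 1) * (N - N * p)) ^ j *
            Real.exp (-(j * (j / (N - N * p) - 1))) := by gcongr
      _ = (N - N * p) ^ j * (Real.exp (j * ((j : ℝ) / (N - N * p) - 1)) *
            Real.exp (-(j * (j / (N - N * p) - 1)))) := by
          rw [mul_pow, ← Real.exp_nat_mul]; ring
      _ = _ := by rw [← Real.exp_add]; simp
  have h3 : Real.exp (-((k - N * p) ^ 2 / (N - N * p))) =
      Real.exp (-k) * Real.exp (-(j * (j / (N - N * p) - 1))) * Real.exp (N * p) := by
    rw [← Real.exp_add, ← Real.exp_add]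
    congr 1
    have : (j : ℝ) = N - k := by linarith
    rw [this]
    field_simp
    ring
  have h4 : 1 - ((k : ℝ) - N * p) ^ 2 / (N - N * p) ≤
      Real.exp (-((k - N * p) ^ 2 / (N - N * p))) := by
    linarith [Real.add_one_le_exp (-(((k : ℝ) - N * p) ^ 2 / (N - N * p)))]
  have hfac : ((k + j).factorial : ℝ) = (k + j).choose k * k.factorial * j.factorial := by
    have := Nat.choose_mul_factorial_mul_factorial (Nat.le_add_right k j)
    rw [Nat.add_sub_cancel_left] at this
    exact_mod_cast this.symm
  have e3 : Real.exp (-(N * p)) * Real.exp (N * p) = 1 := by rw [← Real.exp_add]; simp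
  have h5 : (j.factorial : ℝ) * Real.exp (-k) * N ^ (k + j) *
      Real.exp (-(j * (j / (N - N * p) - 1))) ≤ ((k + j).factorial : ℝ) * (N - N * p) ^ j :=
    calc _ ≤ ((k + j).factorial : ℝ) * (j : ℝ) ^ j *
          Real.exp (-(j * (j / (N - N * p) - 1))) := by gcongr
      _ = ((k + j).factorial : ℝ) * ((j : ℝ) ^ j *
          Real.exp (-(j * (j / (N - N * p) - 1)))) := by ring
      _ ≤ _ := by gcongr
  have h6 : Real.exp (-k) * N ^ k * Real.exp (-(j * (j / (N - N * p) - 1))) ≤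
      (k + j).choose k * k.factorial * (1 - p) ^ j := by
    have hc : 0 < (j.factorial : ℝ) * N ^ j := by positivity
    refine le_of_mul_le_mul_left ?_ hc
    calc _ = (j.factorial : ℝ) * Real.exp (-k) * N ^ (k + j) *
          Real.exp (-(j * (j / (N - N * p) - 1))) := by ring
      _ ≤ _ := h5
      _ = _ := by
        rw [hfac, show N - N * p = N * (1 - p) by ring, mul_pow]; ring
  calc _ ≤ Real.exp (-(N * p)) * (N * p) ^ k / k.factorial *
        Real.exp (-((k - N * p) ^ 2 / (N - N * p))) := by gcongr
    _ = (p ^ k / k.factorial) * (Real.exp (-k) * N ^ k *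
          Real.exp (-(j * (j / (N - N * p) - 1)))) * (Real.exp (-(N * p)) * Real.exp (N * p)) := by
        rw [h3, mul_pow]; ring
    _ ≤ (p ^ k / k.factorial) * ((k + j).choose k * k.factorial * (1 - p) ^ j) *
          (Real.exp (-(N * p)) * Real.exp (N * p)) := by gcongr
    _ = _ := by
        rw [e3]
        field_simp

open Classical in
/-- One-sided total variation bound: the binomial distribution with mean `r = n p` gives every
set at least its Poisson probability minus `p / (1 - p)`, uniformly in `n`. -/
lemma poissonMeasure_sub_le_sum_binomial {n : ℕ} {p : ℝ} (hp0 : 0 ≤ p) (hp1 : p < 1)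
    (hn : 1 ≤ n * (1 - p)) (r : ℝ≥0) (hr : (r : ℝ) = n * p) (S : Set ℕ) :
    (poissonMeasure r).real S - p / (1 - p) ≤
      ∑ k ∈ Finset.range (n + 1), if k ∈ S then n.choose k * p ^ k * (1 - p) ^ (n - k) else 0 := by
  have hq : 0 < 1 - p := by linarith
  have hn0 : 0 < n := by
    rcases Nat.eq_zero_or_pos n with rfl | h
    · norm_num at hn
    · exact h
  have hn0' : (0 : ℝ) < n := by exact_mod_cast hn0
  have hs := (poissonMeasure_hasSum_indicator r S).sub
    ((poisson_hasSum_variance r).mul_right (1 / (n - n * p)))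
  have hv : (r : ℝ) * (1 / (n - n * p)) = p / (1 - p) := by
    rw [hr]; field_simp
  rw [hv] at hs
  refine hasSum_le (fun k ↦ ?_) hs (hasSum_sum_of_ne_finset_zero fun k hk ↦ ?_)
  · have hp : 0 ≤ Real.exp (-(r : ℝ)) * (r : ℝ) ^ k / k.factorial := by positivity
    rw [mul_assoc, ← mul_sub, mul_one_div]
    have hsq : 0 ≤ ((k : ℝ) - r) ^ 2 / (n - n * p) :=
      div_nonneg (sq_nonneg _) (by nlinarith)
    by_cases hkS : k ∈ S
    · rw [Set.indicator_of_mem hkS, if_pos hkS, Pi.one_apply]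
      rcases le_or_gt k n with hkn | hkn
      · rw [hr]
        exact poisson_mul_le_binomial hkn hn0 hp0 hp1
      · -- beyond `n` the binomial weight vanishes, and `(k - r) ^ 2 ≥ (n - r) ^ 2 ≥ n - r`
        rw [Nat.choose_eq_zero_of_lt hkn]
        have hkn' : (n : ℝ) < k := by exact_mod_cast hkn
        have : 1 ≤ ((k : ℝ) - r) ^ 2 / (n - n * p) := by
          rw [le_div_iff₀ (by nlinarith), hr]
          nlinarith
        have := mul_nonpos_of_nonneg_of_nonpos hp (sub_nonpos.mpr this)
        simpa using this
    · rw [Set.indicator_of_notMem hkS, if_neg hkS]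
      exact mul_nonpos_of_nonneg_of_nonpos hp (by linarith)
  · have : n < k := by simpa using hk
    simp [Nat.choose_eq_zero_of_lt this]

/-! ### Distribution of a counter load -/

/-- The number of legitimate flows that `g` hashes to the counter `c`. -/
def load {m n : ℕ} (c : Fin m) (g : Fin n → Fin m) : ℕ :=
  (Finset.univ.filter fun i ↦ g i = c).card

lemma load_le {m n : ℕ} (c : Fin m) (g : Fin n → Fin m) : load c g ≤ n :=
  (Finset.card_le_univ _).trans_eq (Fintype.card_fin n)

lemma card_load_eq {m n : ℕ} (c : Fin m) (k : ℕ) :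
    (Finset.univ.filter fun g : Fin n → Fin m ↦ load c g = k).card =
      n.choose k * (m - 1) ^ (n - k) := by
  -- the preimages of `c` are the `k`-element sets `s`; off `s` all other counters are allowed
  have hfib : ∀ s ∈ Finset.powersetCard k (Finset.univ : Finset (Fin n)),
      (Finset.univ.filter fun g : Fin n → Fin m ↦ (Finset.univ.filter fun i ↦ g i = c) = s).card =
        (m - 1) ^ (n - k) := by
    intro s hs
    have hsk := (Finset.mem_powersetCard.mp hs).2
    have : (Finset.univ.filter fun g : Fin n → Fin m ↦
        (Finset.univ.filter fun i ↦ g i = c) = s) =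
        Fintype.piFinset fun i ↦ if i ∈ s then {c} else Finset.univ.erase c := by
      ext g
      simp only [Finset.mem_filter, Finset.mem_univ, true_and, Fintype.mem_piFinset,
        Finset.ext_iff]
      refine forall_congr' fun i ↦ ?_
      by_cases hi : i ∈ s <;> simp [hi]
    rw [this, Fintype.card_piFinset]
    simp_rw [apply_ite Finset.card, Finset.card_singleton,
      Finset.card_erase_of_mem (Finset.mem_univ c), Finset.card_univ, Fintype.card_fin]
    rw [Finset.prod_ite, Finset.prod_const_one, one_mul, Finset.prod_const]
    congr 1
    rw [Finset.filter_not, Finset.card_sdiff_of_subset (Finset.filter_subset _ _)]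
    simp [hsk]
  rw [Finset.card_eq_sum_card_fiberwise (t := Finset.powersetCard k Finset.univ)
    (f := fun g : Fin n → Fin m ↦ Finset.univ.filter fun i ↦ g i = c)]
  · rw [Finset.sum_congr rfl (g := fun _ ↦ (m - 1) ^ (n - k))]
    · simp
    · intro s hs
      rw [← hfib s hs, Finset.filter_filter]
      congr 1
      ext g
      simp only [Finset.mem_filter, Finset.mem_univ, true_and, and_iff_right_iff_imp]
      rintro rfl
      exact (Finset.mem_powersetCard.mp hs).2
  · intro g hg
    have hg' := (Finset.mem_filter.mp (Finset.mem_coe.mp hg)).2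
    simpa [load] using hg'

open Classical in
/-- The probability that the load of the counter `c` lies in `S`, for a uniformly random
assignment of `n` flows to `m` counters. -/
noncomputable def loadProb {m : ℕ} (n : ℕ) (c : Fin m) (S : Set ℕ) : ℝ :=
  (Finset.univ.filter fun g : Fin n → Fin m ↦ load c g ∈ S).card / (m : ℝ) ^ n

open Classical in
lemma loadProb_eq_sum_binomial {m : ℕ} (n : ℕ) (c : Fin m) (S : Set ℕ) :
    loadProb n c S = ∑ k ∈ Finset.range (n + 1),
      if k ∈ S then n.choose k * (1 / m : ℝ) ^ k * (1 - 1 / m) ^ (n - k) else 0 := by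
  have hm : 1 ≤ m := Fin.pos c
  have hm0 : (m : ℝ) ≠ 0 := by positivity
  rw [loadProb, Finset.card_eq_sum_card_fiberwise (t := Finset.range (n + 1)) (f := load c)
    (fun g _ ↦ by simpa [Nat.lt_succ_iff] using load_le c g), Nat.cast_sum, Finset.sum_div]
  refine Finset.sum_congr rfl fun k hk ↦ ?_
  rw [Finset.filter_filter]
  split_ifs with h
  · have : (Finset.univ.filter fun g : Fin n → Fin m ↦ load c g ∈ S ∧ load c g = k) =
        Finset.univ.filter fun g : Fin n → Fin m ↦ load c g = k := by
      ext g
      simp only [Finset.mem_filter, Finset.mem_univ, true_and, and_iff_right_iff_imp]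
      rintro rfl
      exact h
    rw [this, card_load_eq]
    obtain ⟨j, rfl⟩ := Nat.exists_eq_add_of_le (Nat.lt_succ_iff.mp (Finset.mem_range.mp hk))
    rw [Nat.add_sub_cancel_left, show (1 : ℝ) - 1 / m = (m - 1) / m by field_simp, div_pow,
      div_pow, pow_add]
    push_cast [hm]
    field_simp
    simp
  · have : (Finset.univ.filter fun g : Fin n → Fin m ↦ load c g ∈ S ∧ load c g = k) = ∅ := by
      ext g
      simp only [Finset.mem_filter, Finset.mem_univ, true_and, Finset.notMem_empty, iff_false]
      rintro ⟨h1, rfl⟩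
      exact h h1
    simp [this]

lemma loadProb_eq_loadProb {m : ℕ} (n : ℕ) (c d : Fin m) (S : Set ℕ) :
    loadProb n c S = loadProb n d S := by
  rw [loadProb_eq_sum_binomial, loadProb_eq_sum_binomial]

/-- The moment generating function of the load of a counter. -/
lemma sum_exp_load {m n : ℕ} (c : Fin m) (θ : ℝ) :
    ∑ g : Fin n → Fin m, Real.exp (θ * load c g) = (Real.exp θ + (m - 1)) ^ n := by
  have hm : 1 ≤ m := Fin.pos c
  have h1 : ∀ g : Fin n → Fin m, Real.exp (θ * load c g) =
      ∏ i, if g i = c then Real.exp θ else 1 := by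
    intro g
    rw [Finset.prod_ite, Finset.prod_const_one, mul_one, Finset.prod_const, ← Real.exp_nat_mul,
      mul_comm]
    rfl
  have h2 : ∑ a : Fin m, (if a = c then Real.exp θ else 1) = Real.exp θ + (m - 1) := by
    rw [← Finset.add_sum_erase _ _ (Finset.mem_univ c), if_pos rfl,
      Finset.sum_congr rfl fun a ha ↦ if_neg (Finset.ne_of_mem_erase ha)]
    simp [Finset.card_erase_of_mem, hm]
  simp_rw [h1]
  have h3 := Finset.prod_univ_sum (fun _ : Fin n ↦ (Finset.univ : Finset (Fin m)))
    fun _ a ↦ if a = c then Real.exp θ else 1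
  rw [Fintype.piFinset_univ, h2, Finset.prod_const, Finset.card_univ, Fintype.card_fin] at h3
  exact h3.symm

/-- The Chernoff bound for the load of a counter. -/
lemma loadProb_gt_le {m n : ℕ} (c : Fin m) {θ : ℝ} (hθ : 0 ≤ θ) (M : ℝ) :
    loadProb n c {k | M < k} ≤
      Real.exp ((n : ℝ) / m * (Real.exp θ - 1) - θ * M) := by
  classical
  have hm : 1 ≤ m := Fin.pos c
  have hm0 : (0 : ℝ) < m := by positivity
  rw [loadProb, div_le_iff₀ (by positivity)]
  have h1 : ((Finset.univ.filter fun g : Fin n → Fin m ↦ load c g ∈ {k : ℕ | M < k}).card : ℝ) *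
      Real.exp (θ * M) ≤ (Real.exp θ + (m - 1)) ^ n := by
    rw [← sum_exp_load c θ, ← nsmul_eq_mul, ← Finset.sum_const]
    refine (Finset.sum_le_sum fun g hg ↦ ?_).trans
      (Finset.sum_le_sum_of_subset_of_nonneg (Finset.subset_univ _) fun _ _ _ ↦ Real.exp_nonneg _)
    have : M < load c g := (Finset.mem_filter.mp hg).2
    gcongr
  have h2 : (Real.exp θ + (m - 1)) ^ n ≤ Real.exp ((n : ℝ) / m * (Real.exp θ - 1)) * (m : ℝ) ^ n := by
    have h := Real.add_one_le_exp ((Real.exp θ - 1) / m)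
    have h3 : Real.exp θ + (m - 1) ≤ Real.exp ((Real.exp θ - 1) / m) * m := by
      calc Real.exp θ + (m - 1) = ((Real.exp θ - 1) / m + 1) * m := by field_simp; ring
        _ ≤ _ := by gcongr
    have h1m : (1 : ℝ) ≤ m := by exact_mod_cast hm
    calc _ ≤ (Real.exp ((Real.exp θ - 1) / m) * m) ^ n := by
          refine pow_le_pow_left₀ ?_ h3 n
          linarith [Real.exp_pos θ]
      _ = _ := by
          rw [mul_pow, ← Real.exp_nat_mul]
          congr 2
          ring
  rw [Real.exp_sub, div_mul_eq_mul_div, le_div_iff₀ (Real.exp_pos _)]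
  exact h1.trans h2

/-- Poisson approximation of the load, with an error that does not depend on `n`. -/
lemma poissonMeasure_sub_le_loadProb {m n : ℕ} (hm : 2 ≤ m) (hmn : m ≤ n) (c : Fin m) (S : Set ℕ) :
    (poissonMeasure ((n : ℝ≥0) / m)).real S - 1 / ((m : ℝ) - 1) ≤ loadProb n c S := by
  have hm2 : (2 : ℝ) ≤ m := by exact_mod_cast hm
  have hmn' : (m : ℝ) ≤ n := by exact_mod_cast hmn
  have hm0 : (m : ℝ) ≠ 0 := by positivity
  have hm1 : (m : ℝ) - 1 ≠ 0 := by linarith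
  have hp1 : (1 : ℝ) / m < 1 := by rw [div_lt_one] <;> linarith
  have h := poissonMeasure_sub_le_sum_binomial (n := n) (p := 1 / (m : ℝ)) (by positivity) hp1 ?_
    ((n : ℝ≥0) / m) (by push_cast; ring) S
  · rw [loadProb_eq_sum_binomial]
    convert h using 2
    field_simp
  · rw [show (n : ℝ) * (1 - 1 / m) = n * (m - 1) / m by field_simp, le_div_iff₀ (by positivity)]
    nlinarith

/-! ### Correct selection in terms of counter loads -/

lemma counterValue_of_ne {m n : ℕ} (T γ α : ℝ) (h : LevelFlow n → Fin m) {c : Fin m}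
    (hc : c ≠ h none) : counterValue T γ α h c = load c (h ∘ some) * (γ * T) := by
  rw [counterValue, Fintype.sum_option, if_neg hc.symm, zero_add, ← Finset.sum_filter]
  simp [load, flowRate]

lemma counterValue_none {m n : ℕ} (T γ α : ℝ) (h : LevelFlow n → Fin m) :
    counterValue T γ α h (h none) = (load (h none) (h ∘ some) + α) * (γ * T) := by
  rw [counterValue, Fintype.sum_option, if_pos rfl, ← Finset.sum_filter]
  simp [load, flowRate]
  ring

/-- If the large flow meets more than `M - α` legitimate flows and no counter receives more than
`M` of them, then the large flow is correctly selected. -/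
lemma correctlySelects_of_load {m n : ℕ} {T γ α M : ℝ} (hT : 0 < T) (hγ : 0 < γ)
    {h : LevelFlow n → Fin m} (h0 : M - α < load (h none) (h ∘ some))
    (h1 : ∀ c, ¬ M < load c (h ∘ some)) : CorrectlySelects T γ α h := by
  intro c hc
  rw [counterValue_of_ne T γ α h hc, counterValue_none]
  have := h1 c
  gcongr
  linarith

/-- The union bound over the `m` counters. Conditionally on the counter of the large flow, the
legitimate flows are still uniformly distributed, and the law of a load is the same for all
counters, so a fixed counter `c₀` can be used throughout. -/
lemma loadProb_sub_le_selectProb {m n : ℕ} {T γ α : ℝ} (hT : 0 < T) (hγ : 0 < γ) (M : ℝ)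
    (c₀ : Fin m) :
    loadProb n c₀ {k | M - α < k} - m * loadProb n c₀ {k | M < k} ≤ selectProb m n T γ α := by
  classical
  have hm : 1 ≤ m := Fin.pos c₀
  have hm0 : (0 : ℝ) < m := by positivity
  -- splits an assignment into the counter of the large flow and the assignment of the others
  let e : (LevelFlow n → Fin m) ≃ Fin m × (Fin n → Fin m) := Equiv.piOptionEquivProd
  let Good : Finset (LevelFlow n → Fin m) := Finset.univ.filter (CorrectlySelects T γ α)
  let U : Finset (LevelFlow n → Fin m) :=
    Finset.univ.filter fun h ↦ load (h none) (h ∘ some) ∈ {k : ℕ | M - α < k}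
  let V : Fin m → Finset (LevelFlow n → Fin m) := fun c ↦
    Finset.univ.filter fun h ↦ load c (h ∘ some) ∈ {k : ℕ | M < k}
  have hsub : U ⊆ Good ∪ Finset.univ.biUnion V := by
    intro h hU
    simp only [U, V, Good, Finset.mem_union, Finset.mem_filter, Finset.mem_univ, true_and,
      Finset.mem_biUnion, Set.mem_ofPred_eq] at hU ⊢
    by_cases hV : ∃ c, M < load c (h ∘ some)
    · exact Or.inr hV
    · exact Or.inl (correctlySelects_of_load hT hγ hU (not_exists.mp hV))
  have hcard : (U.card : ℝ) ≤ Good.card + ∑ c, ((V c).card : ℝ) := by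
    exact_mod_cast (Finset.card_le_card hsub).trans
      ((Finset.card_union_le _ _).trans (by gcongr; exact Finset.card_biUnion_le))
  have hcount : ∀ (c : Fin m) (S : Set ℕ),
      ((Finset.univ.filter fun g : Fin n → Fin m ↦ load c g ∈ S).card : ℝ) =
        loadProb n c₀ S * (m : ℝ) ^ n := by
    intro c S
    rw [loadProb_eq_loadProb n c₀ c, loadProb]
    field_simp
  have hU : (U.card : ℝ) = m * (loadProb n c₀ {k | M - α < k} * (m : ℝ) ^ n) := by
    have : U.card = ∑ c : Fin m,
        (Finset.univ.filter fun g : Fin n → Fin m ↦ load c g ∈ {k : ℕ | M - α < k}).card := by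
      simp only [U, Finset.card_filter]
      rw [← Fintype.sum_prod_type', ← e.sum_comp]
      rfl
    rw [this, Nat.cast_sum, Finset.sum_congr rfl fun c _ ↦ hcount c _]
    simp
  have hV : ∀ c, ((V c).card : ℝ) = m * (loadProb n c₀ {k | M < k} * (m : ℝ) ^ n) := by
    intro c
    have : (V c).card = ∑ _d : Fin m,
        (Finset.univ.filter fun g : Fin n → Fin m ↦ load c g ∈ {k : ℕ | M < k}).card := by
      simp only [V, Finset.card_filter]
      rw [← Fintype.sum_prod_type', ← e.sum_comp]
      rfl
    rw [this, Nat.cast_sum, Finset.sum_congr rfl fun _ _ ↦ hcount c _]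
    simp
  have hGood : selectProb m n T γ α = Good.card / (m : ℝ) ^ (n + 1) := by
    rw [selectProb, Fintype.card_subtype]
    simp [Good]
  rw [hGood, le_div_iff₀ (by positivity)]
  simp_rw [hU, hV] at hcard
  simp only [Finset.sum_const, Finset.card_univ, Fintype.card_fin, nsmul_eq_mul] at hcard
  rw [pow_succ]
  linarith

/-! ### Upper tail of a counter load -/

lemma exp_le_cubic {θ : ℝ} (h0 : 0 ≤ θ) (h1 : θ ≤ 1) :
    Real.exp θ ≤ 1 + θ + θ ^ 2 / 2 + θ ^ 3 / 2 := by
  have h := Real.exp_bound' h0 h1 (n := 3) (by norm_num)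
  norm_num [Finset.sum_range_succ, Nat.factorial] at h
  nlinarith [pow_nonneg h0 3]

lemma le_of_mul_sq_le {r θ b : ℝ} (hr : 0 < r) (hb : 0 ≤ b) (h : r * θ ^ 2 ≤ b ^ 2 * r) : θ ≤ b := by
  refine le_of_pow_le_pow_left₀ two_ne_zero hb (le_of_mul_le_mul_left ?_ hr)
  rwa [mul_comm r (b ^ 2)]

/-- The relative deviation `θ = √(2 r L) / r` of the threshold `r + √(2 r L)` from the mean `r`. -/
lemma exists_relative_deviation {r L : ℝ} (hr : 0 < r) (hL : 0 ≤ L) :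
    ∃ θ : ℝ, 0 ≤ θ ∧ r * θ ^ 2 = 2 * L ∧ √(2 * r * L) = r * θ := by
  have h : r * √(2 * L / r) ^ 2 = 2 * L := by
    rw [Real.sq_sqrt (by positivity)]
    field_simp
  refine ⟨√(2 * L / r), Real.sqrt_nonneg _, h, ?_⟩
  rw [show 2 * r * L = (r * √(2 * L / r)) ^ 2 by linear_combination (-r) * h]
  exact Real.sqrt_sq (by positivity)

/-- The Chernoff bound at the relative deviation `θ` with `r θ ^ 2 = 2 log n`, where `r = n / m`.
The excess of `M` over `r + r θ` has to make up for the cubic term of the exponent. -/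
lemma loadProb_gt_le_inv {m n : ℕ} (c : Fin m) (hn : 1 ≤ n) {θ M : ℝ} (hθ0 : 0 ≤ θ) (hθ1 : θ ≤ 1)
    (hθ : (n : ℝ) / m * θ ^ 2 = 2 * Real.log n)
    (hM : ((n : ℝ) / m + (n : ℝ) / m * θ + Real.log n) * θ ≤ M * θ) :
    loadProb n c {k | M < k} ≤ 1 / n := by
  have hn0 : (0 : ℝ) < n := by exact_mod_cast hn
  refine (loadProb_gt_le c hθ0 M).trans ?_
  rw [one_div, ← Real.le_log_iff_exp_le (by positivity), Real.log_inv]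
  have hr : 0 ≤ (n : ℝ) / m := by positivity
  set r := (n : ℝ) / m
  have h2 : r * (Real.exp θ - 1) ≤ r * (θ + θ ^ 2 / 2 + θ ^ 3 / 2) := by
    gcongr
    linarith [exp_le_cubic hθ0 hθ1]
  have h3 : r * (θ + θ ^ 2 / 2 + θ ^ 3 / 2) = r * θ + Real.log n + Real.log n * θ := by
    linear_combination (1 / 2 + θ / 2) * hθ
  have h4 : (r + r * θ + Real.log n) * θ = r * θ + 2 * Real.log n + Real.log n * θ := by
    linear_combination hθ
  linarith

/-- The threshold for `n ≫ m (log m) ^ 2`: raising `r + √(2 r log n)` by `log n` absorbs the cubic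
term of the exponent. -/
lemma loadProb_gt_add_log_le {m n : ℕ} (c : Fin m) (hn : 1 ≤ n)
    (h1 : 2 * Real.log n ≤ (n : ℝ) / m) :
    loadProb n c {k | (n : ℝ) / m + √(2 * ((n : ℝ) / m) * Real.log n) + Real.log n < k} ≤
      1 / n := by
  have hm : 1 ≤ m := Fin.pos c
  have hr : 0 < (n : ℝ) / m := by positivity
  obtain ⟨θ, hθ0, hθ, hs⟩ := exists_relative_deviation hr (Real.log_natCast_nonneg n)
  rw [hs]
  exact loadProb_gt_le_inv c hn hθ0 (le_of_mul_sq_le hr zero_le_one (by linarith)) hθ le_rfl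

/-- The threshold for `n ≫ m log m`: the factor `lam > 1` absorbs the cubic term of the
exponent. -/
lemma loadProb_gt_mul_sqrt_le {m n : ℕ} (c : Fin m) (hn : 1 ≤ n) {lam : ℝ} (hlam : 1 < lam)
    (h1 : 2 * Real.log n ≤ (n : ℝ) / m)
    (h2 : 2 * Real.log n ≤ (2 * (lam - 1)) ^ 2 * ((n : ℝ) / m)) :
    loadProb n c {k | (n : ℝ) / m + lam * √(2 * ((n : ℝ) / m) * Real.log n) < k} ≤ 1 / n := by
  have hm : 1 ≤ m := Fin.pos c
  have hr : 0 < (n : ℝ) / m := by positivity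
  have hL := Real.log_natCast_nonneg n
  obtain ⟨θ, hθ0, hθ, hs⟩ := exists_relative_deviation hr hL
  rw [hs]
  refine loadProb_gt_le_inv c hn hθ0 (le_of_mul_sq_le hr zero_le_one (by linarith)) hθ ?_
  have hθ1 : θ ≤ 2 * (lam - 1) := le_of_mul_sq_le hr (by linarith) (by linarith)
  set r := (n : ℝ) / m
  have h3 : (r + lam * (r * θ)) * θ - (r + r * θ + Real.log n) * θ =
      Real.log n * (2 * (lam - 1) - θ) := by
    linear_combination (lam - 1) * hθ
  have h4 : 0 ≤ Real.log n * (2 * (lam - 1) - θ) := mul_nonneg hL (by linarith)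
  linarith

/-! ### Shifting a Poisson threshold -/

lemma one_sub_poissonCDF_floor (x : ℝ) (r : ℝ≥0) :
    1 - poissonCDF ⌊x⌋ r = (poissonMeasure r).real {k | x < k} := by
  have h : {k : ℕ | x < k} = {k : ℕ | (k : ℤ) ≤ ⌊x⌋}ᶜ := by
    ext k
    simp [Int.le_floor]
  rw [poissonCDF, h, probReal_compl_eq_one_sub .of_discrete]

/-- Raising a threshold by `δ` costs at most `δ + 1` Poisson weights. -/
lemma poissonMeasure_gt_le_gt_add {r : ℝ≥0} (hr : 1 ≤ r) (x : ℝ) {δ : ℝ} (hδ : 0 ≤ δ) :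
    (poissonMeasure r).real {k | x < k} ≤
      (poissonMeasure r).real {k | x + δ < k} + (δ + 1) * (4 / √r) := by
  -- `F` contains the integers between the two thresholds; negative ones are truncated to `0`
  let F : Finset ℕ := (Finset.Ioc ⌊x⌋ ⌊x + δ⌋).image Int.toNat
  have hF : (F.card : ℝ) ≤ δ + 1 := by
    have h1 : (F.card : ℝ) ≤ (⌊x + δ⌋ - ⌊x⌋).toNat := by
      exact_mod_cast Finset.card_image_le.trans_eq (Int.card_Ioc _ _)
    have h2 : ((⌊x + δ⌋ - ⌊x⌋).toNat : ℝ) = ⌊x + δ⌋ - ⌊x⌋ := by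
      have : 0 ≤ ⌊x + δ⌋ - ⌊x⌋ := sub_nonneg.mpr (Int.floor_mono (by linarith))
      exact_mod_cast congrArg (Int.cast : ℤ → ℝ) (Int.toNat_of_nonneg this)
    linarith [Int.floor_le (x + δ), Int.sub_one_lt_floor x]
  have hsub : {k : ℕ | x < k} ⊆ {k : ℕ | x + δ < k} ∪ F := by
    intro k hk
    have hk : x < k := hk
    by_cases h : x + δ < k
    · exact Or.inl h
    · refine Or.inr (Finset.mem_coe.mpr (Finset.mem_image.mpr ⟨k, ?_, Int.toNat_natCast k⟩))
      rw [Finset.mem_Ioc, Int.floor_lt, Int.le_floor]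
      exact ⟨by exact_mod_cast hk, by exact_mod_cast not_lt.mp h⟩
  calc _ ≤ (poissonMeasure r).real ({k : ℕ | x + δ < k} ∪ F) := measureReal_mono hsub
    _ ≤ (poissonMeasure r).real {k | x + δ < k} + (poissonMeasure r).real F :=
        measureReal_union_le _ _
    _ ≤ _ := by
        gcongr
        rw [← sum_measureReal_singleton]
        calc _ ≤ ∑ _k ∈ F, 4 / √(r : ℝ) :=
              Finset.sum_le_sum fun k _ ↦ poissonMeasure_real_singleton_le hr k
          _ = F.card * (4 / √r) := by rw [Finset.sum_const, nsmul_eq_mul]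
          _ ≤ _ := by gcongr

/-! ### Poisson lower bound for the selection probability -/

/-- If no counter is likely to exceed `M`, the selection probability is at least the Poisson
probability of exceeding `M - α`, up to `1 / (m - 1)` for the Poisson approximation and `m / n`
for the union bound. -/
lemma poissonMeasure_sub_le_selectProb {m n : ℕ} (hm : 2 ≤ m) (hmn : m ≤ n) {T γ α M : ℝ}
    (hT : 0 < T) (hγ : 0 < γ) (hM : ∀ c : Fin m, loadProb n c {k | M < k} ≤ 1 / n) :
    (poissonMeasure ((n : ℝ≥0) / m)).real {k | M - α < k} - 1 / ((m : ℝ) - 1) -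
      1 / ((n : ℝ) / m) ≤ selectProb m n T γ α := by
  let c₀ : Fin m := ⟨0, by omega⟩
  have h1 := loadProb_sub_le_selectProb (n := n) (α := α) hT hγ M c₀
  have h2 := poissonMeasure_sub_le_loadProb hm hmn c₀ {k | M - α < k}
  have h3 : (m : ℝ) * loadProb n c₀ {k | M < k} ≤ 1 / ((n : ℝ) / m) := by
    calc _ ≤ (m : ℝ) * (1 / n) := by gcongr; exact hM c₀
      _ = _ := by rw [one_div_div, mul_one_div]
  linarith

/-! ### Asymptotics of the thresholds -/

lemma one_le_log_natCast {m : ℕ} (hm : 3 ≤ m) : 1 ≤ Real.log m := by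
  have hm3 : (3 : ℝ) ≤ m := by exact_mod_cast hm
  rw [Real.le_log_iff_exp_le (by linarith)]
  linarith [Real.exp_one_lt_three]

lemma log_eq_log_add_log_div {m n : ℕ} (hm : 3 ≤ m) (hn : 0 < (n : ℝ) / m) :
    Real.log n = Real.log m + Real.log ((n : ℝ) / m) := by
  have hm0 : (m : ℝ) ≠ 0 := by positivity
  rw [← Real.log_mul hm0 hn.ne']
  congr 1
  field_simp

/-- If `n ≥ C m log m` with `C` large, then `log n` is small compared with `n / m`, since
`log n = log m + log (n / m)` and both terms are. -/
lemma exists_log_le_mul_div {η : ℝ} (hη : 0 < η) (B : ℝ) :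
    ∃ C : ℝ, B ≤ C ∧ ∀ m n : ℕ, 3 ≤ m → C * ((m : ℝ) * Real.log m) ≤ n →
      C ≤ (n : ℝ) / m ∧ Real.log n ≤ η * ((n : ℝ) / m) := by
  obtain ⟨R, hR⟩ := Filter.eventually_atTop.mp
    (Real.isLittleO_log_id_atTop.bound (half_pos hη))
  refine ⟨max B (max R (max 1 (2 / η))), le_max_left _ _, fun m n hm hmn ↦ ?_⟩
  set C := max B (max R (max 1 (2 / η)))
  have hCR : R ≤ C := (le_max_left _ _).trans (le_max_right _ _)
  have hC1 : 1 ≤ C := (le_max_left _ _).trans ((le_max_right _ _).trans (le_max_right _ _))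
  have hCη : 2 / η ≤ C := (le_max_right _ _).trans ((le_max_right _ _).trans (le_max_right _ _))
  have hm0 : (0 : ℝ) < m := by positivity
  have hl := one_le_log_natCast hm
  have h1 : C * Real.log m ≤ (n : ℝ) / m := by
    rw [le_div_iff₀ hm0]
    linarith
  have h2 : C ≤ (n : ℝ) / m := by nlinarith
  refine ⟨h2, ?_⟩
  rw [log_eq_log_add_log_div hm (by linarith)]
  set r := (n : ℝ) / m
  have h3 : Real.log r ≤ η / 2 * r := by
    have h := hR r (hCR.trans h2)
    rw [id, Real.norm_of_nonneg (by linarith : (0 : ℝ) ≤ r)] at h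
    exact (Real.le_norm_self _).trans h
  have h4 : Real.log m ≤ η / 2 * r := by
    rw [div_le_iff₀ hη] at hCη
    nlinarith
  linarith

/-- If `n ≥ C m (log m) ^ 2` with `C` large, then `log n` is small compared with the standard
deviation `√(n / m)` of a counter load. -/
lemma exists_log_le_mul_sqrt_div {η : ℝ} (hη : 0 < η) (B : ℝ) :
    ∃ C : ℝ, B ≤ C ∧ ∀ m n : ℕ, 3 ≤ m → C * ((m : ℝ) * Real.log m ^ 2) ≤ n →
      C ≤ (n : ℝ) / m ∧ Real.log n ≤ η * √((n : ℝ) / m) := by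
  obtain ⟨R, hR⟩ := Filter.eventually_atTop.mp
    ((isLittleO_log_rpow_atTop (r := 1 / 2) (by norm_num)).bound (half_pos hη))
  refine ⟨max B (max R (max 1 ((2 / η) ^ 2))), le_max_left _ _, fun m n hm hmn ↦ ?_⟩
  set C := max B (max R (max 1 ((2 / η) ^ 2)))
  have hCR : R ≤ C := (le_max_left _ _).trans (le_max_right _ _)
  have hC1 : 1 ≤ C := (le_max_left _ _).trans ((le_max_right _ _).trans (le_max_right _ _))
  have hCη : (2 / η) ^ 2 ≤ C :=
    (le_max_right _ _).trans ((le_max_right _ _).trans (le_max_right _ _))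
  have hm0 : (0 : ℝ) < m := by positivity
  have hl := one_le_log_natCast hm
  have h1 : C * Real.log m ^ 2 ≤ (n : ℝ) / m := by
    rw [le_div_iff₀ hm0]
    linarith
  have h2 : C ≤ (n : ℝ) / m := (le_mul_of_one_le_right (by linarith) (one_le_pow₀ hl)).trans h1
  refine ⟨h2, ?_⟩
  rw [log_eq_log_add_log_div hm (by linarith)]
  set r := (n : ℝ) / m
  have h3 : Real.log r ≤ η / 2 * √r := by
    have h := hR r (hCR.trans h2)
    rw [← Real.sqrt_eq_rpow, Real.norm_of_nonneg (Real.sqrt_nonneg r)] at h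
    exact (Real.le_norm_self _).trans h
  have h4 : Real.log m ≤ η / 2 * √r := by
    have : 2 / η * Real.log m ≤ √r := by
      refine Real.le_sqrt_of_sq_le ?_
      rw [mul_pow]
      refine le_trans ?_ h1
      gcongr
    calc Real.log m = η / 2 * (2 / η * Real.log m) := by field_simp
      _ ≤ _ := by gcongr
  linarith

lemma one_div_le_of_ceil_le {ε : ℝ} (hε : 0 < ε) {m : ℕ} (hm : 3 ≤ m) (h : ⌈1 / ε⌉₊ + 1 ≤ m) :
    1 / ((m : ℝ) - 1) ≤ ε := by
  have h1 : (⌈1 / ε⌉₊ : ℝ) + 1 ≤ m := by exact_mod_cast h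
  have h2 := Nat.le_ceil (1 / ε)
  have hm3 : (3 : ℝ) ≤ m := by exact_mod_cast hm
  rw [div_le_iff₀ (by linarith)]
  rw [div_le_iff₀ hε] at h2
  nlinarith

theorem mainTheorem2 :
    (∀ ε : ℝ, 0 < ε → ∃ (m₀ : ℕ) (C : ℝ), ∀ m n : ℕ, m₀ ≤ m →
      C * ((m : ℝ) * Real.log m ^ 2) ≤ (n : ℝ) →
      ∀ T γ α : ℝ, 0 < T → 0 < γ → 1 < α →
        1 - poissonCDF
              ⌊(n : ℝ) / m + Real.sqrt (2 * ((n : ℝ) / m) * Real.log n) - α⌋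
              ((n : ℝ≥0) / m) - ε
          ≤ selectProb m n T γ α) ∧
    (∀ lam : ℝ, 1 < lam → ∀ ε : ℝ, 0 < ε → ∃ (m₀ : ℕ) (C : ℝ), ∀ m n : ℕ, m₀ ≤ m →
      C * ((m : ℝ) * Real.log m) ≤ (n : ℝ) →
      ∀ T γ α : ℝ, 0 < T → 0 < γ → 1 < α →
        1 - poissonCDF
              ⌊(n : ℝ) / m + lam * Real.sqrt (2 * ((n : ℝ) / m) * Real.log n) - α⌋
              ((n : ℝ≥0) / m) - ε
          ≤ selectProb m n T γ α) := by
  constructor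
  · intro ε hε
    -- the errors: `ε / 4` Poisson approximation, `ε / 4` union bound, `ε / 2` shifted threshold
    obtain ⟨C, hC, hlog⟩ := exists_log_le_mul_sqrt_div
      (η := min (1 / 2) (ε / 16)) (by positivity) (max 1 (max (4 / ε) ((16 / ε) ^ 2)))
    refine ⟨max 3 (⌈1 / (ε / 4)⌉₊ + 1), C, fun m n hm hmn T γ α hT hγ _ ↦ ?_⟩
    have hm3 : 3 ≤ m := (le_max_left _ _).trans hm
    have hm0 : (0 : ℝ) < m := by positivity
    obtain ⟨hCr, hL⟩ := hlog m n hm3 hmn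
    have hr1 : 1 ≤ (n : ℝ) / m := ((le_max_left _ _).trans hC).trans hCr
    have hr4 : 4 / ε ≤ (n : ℝ) / m :=
      (((le_max_left _ _).trans (le_max_right _ _)).trans hC).trans hCr
    have hr16 : (16 / ε) ^ 2 ≤ (n : ℝ) / m :=
      (((le_max_right _ _).trans (le_max_right _ _)).trans hC).trans hCr
    have hmn' : m ≤ n := by
      rw [one_le_div hm0] at hr1
      exact_mod_cast hr1
    have hcoe : (((n : ℝ≥0) / m : ℝ≥0) : ℝ) = (n : ℝ) / m := by push_cast; rfl
    have hL0 : 0 ≤ Real.log n := Real.log_natCast_nonneg n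
    have hs0 : 0 < √((n : ℝ) / m) := Real.sqrt_pos.mpr (by linarith)
    have hss : √((n : ℝ) / m) ≤ (n : ℝ) / m := by
      rw [Real.sqrt_le_left (by linarith)]
      nlinarith
    have hL1 : Real.log n ≤ 1 / 2 * √((n : ℝ) / m) :=
      hL.trans (by gcongr; exact min_le_left _ _)
    have hL2 : Real.log n ≤ ε / 16 * √((n : ℝ) / m) :=
      hL.trans (by gcongr; exact min_le_right _ _)
    have h1 := poissonMeasure_sub_le_selectProb (α := α) (by omega : 2 ≤ m) hmn' hT hγ
      fun c ↦ loadProb_gt_add_log_le c (by omega) (by linarith)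
    have h2 := poissonMeasure_gt_le_gt_add (r := (n : ℝ≥0) / m)
      (by rw [← NNReal.coe_le_coe, hcoe]; exact_mod_cast hr1)
      ((n : ℝ) / m + √(2 * ((n : ℝ) / m) * Real.log n) - α) hL0
    rw [sub_add_eq_add_sub, hcoe] at h2
    have h3 := one_div_le_of_ceil_le (by positivity) hm3 ((le_max_right _ _).trans hm)
    have h4 : 1 / ((n : ℝ) / m) ≤ ε / 4 := by
      rw [div_le_iff₀ hε] at hr4
      rw [div_le_iff₀ (by linarith)]
      linarith
    have h5 : (Real.log n + 1) * (4 / √((n : ℝ) / m)) ≤ ε / 2 := by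
      have h6 := Real.le_sqrt_of_sq_le hr16
      rw [div_le_iff₀ hε] at h6
      rw [← mul_div_assoc, div_le_iff₀ hs0]
      linarith
    rw [one_sub_poissonCDF_floor]
    linarith
  · intro lam hlam ε hε
    have hlam' : 0 < (2 * (lam - 1)) ^ 2 := by nlinarith
    obtain ⟨C, hC, hlog⟩ := exists_log_le_mul_div
      (η := min (1 / 2) ((2 * (lam - 1)) ^ 2 / 2)) (by positivity) (max 1 (2 / ε))
    refine ⟨max 3 (⌈1 / (ε / 2)⌉₊ + 1), C, fun m n hm hmn T γ α hT hγ _ ↦ ?_⟩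
    have hm3 : 3 ≤ m := (le_max_left _ _).trans hm
    have hm0 : (0 : ℝ) < m := by positivity
    obtain ⟨hCr, hL⟩ := hlog m n hm3 hmn
    have hr1 : 1 ≤ (n : ℝ) / m := ((le_max_left _ _).trans hC).trans hCr
    have hr2 : 2 / ε ≤ (n : ℝ) / m := ((le_max_right _ _).trans hC).trans hCr
    have hmn' : m ≤ n := by
      rw [one_le_div hm0] at hr1
      exact_mod_cast hr1
    have hL1 : Real.log n ≤ 1 / 2 * ((n : ℝ) / m) :=
      hL.trans (by gcongr; exact min_le_left _ _)
    have hL2 : Real.log n ≤ (2 * (lam - 1)) ^ 2 / 2 * ((n : ℝ) / m) :=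
      hL.trans (by gcongr; exact min_le_right _ _)
    have h1 := poissonMeasure_sub_le_selectProb (α := α) (by omega : 2 ≤ m) hmn' hT hγ
      fun c ↦ loadProb_gt_mul_sqrt_le c (by omega) hlam (by linarith) (by linarith)
    have h3 := one_div_le_of_ceil_le (by positivity) hm3 ((le_max_right _ _).trans hm)
    have h4 : 1 / ((n : ℝ) / m) ≤ ε / 2 := by
      rw [div_le_iff₀ hε] at hr2
      rw [div_le_iff₀ (by linarith)]
      linarith
    rw [one_sub_poissonCDF_floor]
    linarith
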